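/- **Notation.** $S_n$ is the set of permutations $\sigma=[\sigma(1),\dots,\sigma(n)]$ of $[n]=\{1,\dots,n\}$. For $1\le i<j\le n$, the transition $t_{i\uparrow j}:S_n\to S_n$ moves the entry in position $j$ to position $i$ and shifts the entries in positions $i,\dots,j-1$ one place to the right; $t_{\uparrow j}=t_{1\uparrow j}$. A $G_{i\uparrow}(n,M)$ is a sequence $(c_r)_{r=1}^M$ of distinct elements of $S_n$ with $c_{r+1}=t_{i\uparrow j_r}(c_r)$ for $1\le r<M$ and $c_1=t_{i\uparrow j_M}(c_M)$, for some $j_1,\dots,j_M\in\{i+1,\dots,n\}$; $t_{i\uparrow j_1},\dots,t_{i\uparrow j_M}$ is its transition sequence, and $G_\uparrow=G_{1\uparrow}$. A $G^{\mathrm{aux}}_\uparrow(k,M)$ is a $G_\uparrow(k,M)$ code $C$ such that $\sigma\in C$ implies $(q,k)\circ\sigma\notin C$ for all $q\in[k-1]$. For $k\ge 3$ let $$\tilde M_k=\begin{cases}8&k=4,\\57&k=5,\\178&k=6,\\ \frac{k!}{2}&k\ne5\text{ odd},\\ \rho_k\frac{k!}{2}&k>6\text{ even},\end{cases}\qquad\text{where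 } \rho_k\frac{k!}{2}=(k-3)\Bigl(\frac{(k-1)!}{2}+2\Bigr)+1 .$$ **Construction.** Let $n>d\ge1$. For $i\in[d]$ let $\mathcal R_i$ be the set of elements of $[n]$ congruent to $i$ modulo $d$, and let $p_m=1+\sum_{i<m}|\mathcal R_i|$. Let $\sigma_0=[\mathcal R_1|\mathcal R_2|\cdots|\mathcal R_d]\in S_n$ be the concatenation of these classes, with any order within each class. Codes $C_m$, each starting at $\sigma_0$ and using transitions $t_{p_m\uparrow j}$, are defined by descending recursion, down to $m=1$. - Base, if $n\ge 2d$: take the transition sequence $t_{\uparrow r_1},t_{\uparrow r_2},\dots$ of any $G_\uparrow(|\mathcal R_d|,|\mathcal R_d|!)$; $C_d$ has the transition sequence $t_{p_d\uparrow p_d-1+r_1},t_{p_d\uparrow p_d-1+r_2},\dots$. - Base, if $n<2d$: for $m=n\bmod d$, $C_m=(\sigma_0,\;t_{2m-1\uparrow2m+1}\sigma_0,\;t_{2m-1\uparrow2m+1}^{2}\sigma_0)$. - Step from $C_{m+1}$ to $C_m$: let $k=|\mathcal R_m|$ and take any $G^{\mathrm{aux}}_\uparrow(k+1,\tilde M_{k+1})$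 code that starts at the identity and whose transition sequence $t_{\uparrow k+1},t_{\uparrow i_2},\dots,t_{\uparrow i_{\tilde M_{k+1}}}$ starts with $t_{\uparrow k+1}$. Replace each transition $t_{p_{m+1}\uparrow j}$ of $C_{m+1}$ with $t_{p_m\uparrow j}$ followed by $t_{p_m\uparrow p_m-1+i_2},\dots,t_{p_m\uparrow p_m-1+i_{\tilde M_{k+1}}}$. **Lemma.** Let $n>d\ge1$ and let $C_1$ be a code obtained by this construction, with any choice of the codes and orders it employs. Then the number $|C_1|$ of its codewords is $$|C_1|=\begin{cases} \left(\lceil\frac nd\rceil+1\right)^{n\bmod d}\left((\lfloor\frac nd\rfloor+1)!\right)^d\cdot\dfrac{\rho_{\lceil n/d\rceil+1}^{\,n\bmod d}}{2^{d-1}(\lfloor n/d\rfloor+1)} & 4<\lfloor\frac nd\rfloor\equiv0\pmod2,\\[1ex] \left(\frac{178}{57}\right)^{n\bmod d}\cdot57^{d-1}\cdot24&\lfloor\frac nd\rfloor=4,\\[1ex] \left(\frac83\right)^{n\bmod d}\cdot3^{d-1}\cdot2&\lfloor\frac nd\rfloor=2,\\[1ex] \left(\lceil\frac nd\rceil+1\right)^{n\bmod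 d}\left((\lfloor\frac nd\rfloor+1)!\right)^d\cdot\dfrac{\rho_{\lfloor n/d\rfloor+1}^{\,(d-1)-(n\bmod d)}}{2^{d-1}(\lfloor n/d\rfloor+1)} & 5<\lfloor\frac nd\rfloor\equiv1\pmod2,\\[1ex] \left(\frac{1260}{89}\right)^{n\bmod d}\cdot178^d\cdot\frac{120}{178}&\lfloor\frac nd\rfloor=5,\\[1ex] \left(\frac{57}{8}\right)^{n\bmod d}\cdot8^d\cdot\frac34&\lfloor\frac nd\rfloor=3,\\[1ex] 3^{n\bmod d}&\lfloor\frac nd\rfloor=1. \end{cases}$$ (When $d\mid n$, the factor $\rho_{\lceil n/d\rceil+1}^{\,n\bmod d}$ is $1$.) Moreover $\rho_k>\frac{k-3}{k}$ for all even $k>6$. -/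

import Mathlib

namespace PushGray

open Equiv

/-! ## Push transitions and push-to-the-`i`th-index Gray codes

The set `{1, …, n}` is modelled by `Fin n`: positions, values and classes are numbered from `0`.
A permutation `σ : Perm (Fin n)` has vector notation `[σ 0, σ 1, …, σ (n - 1)]`. -/

/-- The transition `t_{i↑j}` on `S_n`: the entry in position `j` is moved to position `i`, and the
entries in positions `i, …, j - 1` move one position to the right. Only used for `i < j < n`; for
other indices it is the identity. In terms of the group it is `σ ↦ σ ∘ (j, j - 1, …, i)`. -/
def push {n : ℕ} (i j : ℕ) (σ : Perm (Fin n)) : Perm (Fin n) :=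
  if h : i < j ∧ j < n then σ * (Fin.cycleIcc ⟨i, h.1.trans h.2⟩ ⟨j, h.2⟩)⁻¹ else σ

/-- The codewords `c_1 = σ, c_2 = t_{i↑j_1} c_1, …, c_M = t_{i↑j_{M-1}} c_{M-1}` of the cyclic
sequence with generating transition sequence `t_{i↑j_1}, …, t_{i↑j_M}`. -/
def codewords {n : ℕ} (i : ℕ) : Perm (Fin n) → List ℕ → List (Perm (Fin n))
  | _, [] => []
  | σ, j :: js => σ :: codewords i (push i j σ) js

/-- The transitions `t_{i↑j_1}, …, t_{i↑j_M}`, applied from `σ`, generate a `G_{i↑}(n, M)`: a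
cyclic Gray code over `S_n`, with distinct codewords, the last transition leading back to `σ`. -/
structure IsPushCode {n : ℕ} (i : ℕ) (σ : Perm (Fin n)) (js : List ℕ) : Prop where
  transitions : ∀ j ∈ js, i < j ∧ j < n
  distinct : (codewords i σ js).Nodup
  cyclic : js.foldl (fun π j => push i j π) σ = σ

/-- The sizes of the auxiliary codes in `S_k`, for `k ≥ 3`. -/
def auxSize (k : ℕ) : ℕ :=
  if k = 4 then 8
  else if k = 5 then 57
  else if k = 6 then 178
  else if k % 2 = 1 then k.factorial / 2
  else (k - 3) * ((k - 1).factorial / 2 + 2) + 1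

/-- The factor `ρ_k`, for even `k > 6`: the ratio of the auxiliary code size to `k! / 2`. -/
def rho (k : ℕ) : ℚ :=
  (((k : ℚ) - 3) * (((k - 1).factorial : ℚ) / 2 + 2) + 1) / ((k.factorial : ℚ) / 2)

/-- `js` is the transition sequence of a `G^aux_↑(k, auxSize k)` that starts with the identity and
the transition `t_{↑k}`: a cyclic push-to-the-top Gray code `C` such that `π ∈ C` implies
`(q, k) ∘ π ∉ C` for all `q ≠ k`. -/
structure IsAuxCode (k : ℕ) (js : List ℕ) : Prop where
  isPushCode : IsPushCode 0 (1 : Perm (Fin k)) js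
  length_eq : js.length = auxSize k
  head_eq : js.head? = some (k - 1)
  aux : ∀ π ∈ codewords 0 (1 : Perm (Fin k)) js, ∀ q l : Fin k, (l : ℕ) + 1 = k → q ≠ l →
    swap q l * π ∉ codewords 0 (1 : Perm (Fin k)) js

/-- `js` is the transition sequence of a complete cyclic `G_↑(k, k!)`. -/
def IsCompleteCode (k : ℕ) (js : List ℕ) : Prop :=
  js.length = k.factorial ∧ ∃ σ : Perm (Fin k), IsPushCode 0 σ js

/-! ## The construction -/

/-- The size of the congruence class `m` modulo `d` of `{0, …, n - 1}`. -/
def classSize (n d m : ℕ) : ℕ := ((Finset.range n).filter fun v => v % d = m).card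

/-- The number of elements of the classes `0, …, m - 1`. -/
def classStart (n d m : ℕ) : ℕ := ∑ i ∈ Finset.range m, classSize n d i

/-- `σ₀ = [R_0 | R_1 | ⋯ | R_{d-1}]`: the concatenation of the congruence classes modulo `d`,
with an arbitrary order within each class. -/
def IsInitial {n : ℕ} (d : ℕ) (σ₀ : Perm (Fin n)) : Prop :=
  ∀ m < d, ∀ p : Fin n, classStart n d m ≤ p → (p : ℕ) < classStart n d (m + 1) →
    (σ₀ p : ℕ) % d = m

/-- The recursion step: each `t_{p'↑j}` is replaced with `t_{p↑j}`, followed by the auxiliary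
transitions except the first one, carried out on the positions `p, p + 1, …`. -/
def expand (p : ℕ) (aux js : List ℕ) : List ℕ :=
  js.flatMap fun j => j :: aux.tail.map fun i => p + i

/-- `IsStage n d m js`: the construction, with parameters `n` and `d` and with some choice of the
codes it employs, produces for the class `m` the transition sequence `t_{p↑j}`, `j ∈ js`, where
`p = classStart n d m`. With classes numbered from `1` this is the code `C_{m+1}`.

* `base`: for `2 * d ≤ n`, the code `C_d` runs through all arrangements of the last class.
* `baseSmall`: for `n < 2 * d`, the recursion starts with `C_r`, `r = n mod d`, which consists of
  three cyclic shifts of the class `R_r` (of size 2) together with one more element.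
* `step`: the recursion step from `C_{m+2}` to `C_{m+1}`. -/
inductive IsStage (n d : ℕ) : ℕ → List ℕ → Prop
  | base (js : List ℕ) (hn : 2 * d ≤ n) (hjs : IsCompleteCode (classSize n d (d - 1)) js) :
      IsStage n d (d - 1) (js.map fun j => classStart n d (d - 1) + j)
  | baseSmall (hn : n < 2 * d) :
      IsStage n d (n % d - 1) (List.replicate 3 (2 * (n % d)))
  | step (m : ℕ) (js aux : List ℕ) (hjs : IsStage n d (m + 1) js)
      (haux : IsAuxCode (classSize n d m + 1) aux) :
      IsStage n d m (expand (classStart n d m) aux js)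

/-- The sequence `C` of permutations is the final code `C_1` of a run of the construction with
parameters `n` and `d`. All its transitions are push-to-the-top transitions. -/
def IsConstructedCode (n d : ℕ) (C : List (Perm (Fin n))) : Prop :=
  ∃ (σ₀ : Perm (Fin n)) (js : List ℕ), IsInitial d σ₀ ∧ IsStage n d 0 js ∧ C = codewords 0 σ₀ js

/-! ## The size formula -/

/-- The case formula for the size of the code. -/
def codeSize (n d : ℕ) : ℚ :=
  let f : ℕ := ⌊(n : ℚ) / d⌋₊
  let c : ℕ := ⌈(n : ℚ) / d⌉₊
  let r : ℕ := n % d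
  if 4 < f ∧ f % 2 = 0 then
    ((c : ℚ) + 1) ^ r * ((f + 1).factorial : ℚ) ^ d * (rho (c + 1) ^ r / (2 ^ (d - 1) * (f + 1)))
  else if f = 4 then (178 / 57) ^ r * 57 ^ (d - 1) * 24
  else if f = 2 then (8 / 3) ^ r * 3 ^ (d - 1) * 2
  else if 5 < f ∧ f % 2 = 1 then
    ((c : ℚ) + 1) ^ r * ((f + 1).factorial : ℚ) ^ d *
      (rho (f + 1) ^ (d - 1 - r) / (2 ^ (d - 1) * (f + 1)))
  else if f = 5 then (1260 / 89) ^ r * 178 ^ d * (120 / 178)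
  else if f = 3 then (57 / 8) ^ r * 8 ^ d * (3 / 4)
  else 3 ^ r

end PushGray

namespace PushGray

open Equiv

/-! ## Transitions as permutations of positions -/

/-! Transitions act on positions, by right multiplication, so a code over `S_k` can be run from any
permutation inside any window of `k` consecutive positions (`IsPushCode.map_window`). In a recursion
step let `p` be the start of a class with `k` elements and `p' = p + k`; the auxiliary code runs on
the `k + 1` positions `p, …, p'`.

Since `t_{p↑j}` is `t_{p'↑j}` followed by `t_{p↑p'}`, the replacement of `t_{p'↑j}` makes the new
code traverse one full auxiliary cycle for each old codeword (`codewords_expand_perm`). Cycles of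
distinct old codewords are disjoint: these codewords agree before `p'`, and a common element would
force them to agree after `p'`, hence everywhere (`eq_of_mul_windowHom_eq`). So each step keeps the
codewords distinct and multiplies their number by the auxiliary size.

With `f = ⌊n/d⌋` and `r = n mod d`, the first `r` classes have `f + 1` elements and the others `f`.
For `2d ≤ n` the size is therefore `f! * auxSize (f + 2) ^ r * auxSize (f + 1) ^ (d - 1 - r)`, and
for `n < 2d` it is `3 ^ r`; the case formula evaluates these expressions. -/

theorem push_eq_mul {n : ℕ} (i j : ℕ) (σ : Perm (Fin n)) : push i j σ = σ * push i j 1 := by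
  unfold push
  split_ifs <;> simp

theorem val_push_one {n i j : ℕ} (hij : i < j) (hj : j < n) (x : Fin n) :
    (push i j (1 : Perm (Fin n)) x : ℕ) =
      if (x : ℕ) = i then j else if i < x ∧ (x : ℕ) ≤ j then (x : ℕ) - 1 else x := by
  have : NeZero n := ⟨by lia⟩
  -- `push` uses the inverse cycle, so its value at `x` is found by exhibiting a preimage `y` with
  -- `cycleIcc y = x`.
  have key (y : Fin n) (h : Fin.cycleIcc ⟨i, hij.trans hj⟩ ⟨j, hj⟩ y = x) :
      push i j (1 : Perm (Fin n)) x = y := by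
    rw [push, dif_pos ⟨hij, hj⟩, one_mul, Perm.inv_eq_iff_eq, h]
  split_ifs with h₁ h₂
  · rw [key ⟨j, hj⟩]
    rw [Fin.cycleIcc_of_last (Fin.mk_le_mk.2 hij.le)]
    exact Fin.ext h₁.symm
  · rw [key ⟨x - 1, by lia⟩]
    rw [Fin.cycleIcc_of_ge_of_lt (Fin.mk_le_mk.2 (by lia)) (Fin.mk_lt_mk.2 (by lia))]
    refine Fin.ext ?_
    rw [Fin.val_add_one_of_lt' (by simp; lia)]
    simp; lia
  · rw [key x]
    rcases lt_or_ge (x : ℕ) i with h | h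
    · exact Fin.cycleIcc_of_lt (Fin.lt_def.2 h)
    · exact Fin.cycleIcc_of_gt (Fin.lt_def.2 (show j < (x : ℕ) by lia))

theorem push_apply_of_lt {n i : ℕ} (j : ℕ) (σ : Perm (Fin n)) {x : Fin n} (hx : (x : ℕ) < i) :
    push i j σ x = σ x := by
  by_cases h : i < j ∧ j < n
  · rw [push_eq_mul, Perm.mul_apply]
    congr 1
    refine Fin.ext ?_
    rw [val_push_one h.1 h.2, if_neg (by lia), if_neg (by lia)]
  · rw [push, dif_neg h]

/-- `t_{p↑j}` is `t_{p'↑j}` followed by `t_{p↑p'}`. -/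
theorem push_push {n p p' j : ℕ} (hp : p < p') (hj : p' < j) (hn : j < n) (σ : Perm (Fin n)) :
    push p p' (push p' j σ) = push p j σ := by
  rw [push_eq_mul, push_eq_mul p' j, push_eq_mul p j, mul_assoc]
  congr 1
  ext x
  rw [Perm.mul_apply, val_push_one hj hn, val_push_one hp (hj.trans hn),
    val_push_one (hp.trans hj) hn]
  split_ifs <;> lia

/-- The embedding of `{0, …, k - 1}` into `{0, …, n - 1}` as the window that starts at `p`. -/
def window {n k p : ℕ} (h : p + k ≤ n) : Fin k ↪ Fin n where
  toFun i := ⟨p + i, by lia⟩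
  inj' i j hij := by
    simpa [Fin.ext_iff] using hij

theorem val_window {n k p : ℕ} (h : p + k ≤ n) (i : Fin k) : (window h i : ℕ) = p + i :=
  rfl

/-- The permutations of positions within a window. -/
noncomputable def windowHom {n k p : ℕ} (h : p + k ≤ n) : Perm (Fin k) →* Perm (Fin n) :=
  Perm.viaEmbeddingHom (window h)

theorem windowHom_apply_window {n k p : ℕ} (h : p + k ≤ n) (π : Perm (Fin k)) (i : Fin k) :
    windowHom h π (window h i) = window h (π i) :=
  Perm.viaEmbedding_apply π (window h) i

theorem exists_window_eq {n k p : ℕ} (h : p + k ≤ n) {x : Fin n} (h₁ : p ≤ x)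
    (h₂ : (x : ℕ) < p + k) : ∃ i : Fin k, window h i = x :=
  ⟨⟨x - p, by lia⟩, Fin.ext (by rw [val_window]; simp; lia)⟩

theorem windowHom_apply_of_notMem {n k p : ℕ} (h : p + k ≤ n) (π : Perm (Fin k)) {x : Fin n}
    (hx : (x : ℕ) < p ∨ p + k ≤ x) : windowHom h π x = x := by
  refine Perm.viaEmbedding_apply_of_notMem π (window h) x ?_
  rintro ⟨i, rfl⟩
  have := i.isLt
  rw [val_window] at hx
  lia

theorem windowHom_push_one {n k p i j : ℕ} (h : p + k ≤ n) (hij : i < j) (hj : j < k) :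
    windowHom h (push i j 1) = push (p + i) (p + j) 1 := by
  ext x
  rw [val_push_one (by lia) (by lia)]
  by_cases hx : (x : ℕ) < p ∨ p + k ≤ x
  · rw [windowHom_apply_of_notMem h _ hx]
    split_ifs <;> lia
  · obtain ⟨y, rfl⟩ := exists_window_eq h (x := x) (by lia) (by lia)
    rw [windowHom_apply_window, val_window, val_window, val_push_one hij hj]
    split_ifs <;> lia

theorem push_mul_windowHom {n k p j : ℕ} (h : p + k ≤ n) (h₀ : 0 < j) (hj : j < k)
    (σ : Perm (Fin n)) (π : Perm (Fin k)) :
    push p (p + j) (σ * windowHom h π) = σ * windowHom h (push 0 j π) := by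
  rw [push_eq_mul, push_eq_mul 0 j π, map_mul, windowHom_push_one h h₀ hj, mul_assoc, add_zero]

/-! ## Codewords -/

theorem codewords_append {n : ℕ} (i : ℕ) (l l' : List ℕ) (σ : Perm (Fin n)) :
    codewords i σ (l ++ l') =
      codewords i σ l ++ codewords i (l.foldl (fun π j => push i j π) σ) l' := by
  induction l generalizing σ with
  | nil => rfl
  | cons j l ih => simp [codewords, ih]

theorem length_codewords {n : ℕ} (i : ℕ) (l : List ℕ) (σ : Perm (Fin n)) :
    (codewords i σ l).length = l.length := by
  induction l generalizing σ with
  | nil => rfl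
  | cons j l ih => simp [codewords, ih]

/-- Transitions `t_{i↑j}` never touch positions before `i`. This supplies the agreement needed to
separate the blocks of the recursion step. -/
theorem apply_eq_of_mem_codewords {n i : ℕ} {l : List ℕ} {σ c : Perm (Fin n)}
    (hc : c ∈ codewords i σ l) {x : Fin n} (hx : (x : ℕ) < i) : c x = σ x := by
  induction l generalizing σ with
  | nil => simp [codewords] at hc
  | cons j l ih =>
    rcases List.mem_cons.1 hc with rfl | hc
    · rfl
    · rw [ih hc, push_apply_of_lt j σ hx]

theorem codewords_mul_windowHom {n k p : ℕ} (h : p + k ≤ n) {l : List ℕ}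
    (hl : ∀ j ∈ l, 0 < j ∧ j < k) (σ : Perm (Fin n)) (π : Perm (Fin k)) :
    codewords p (σ * windowHom h π) (l.map (p + ·)) =
      (codewords 0 π l).map fun τ => σ * windowHom h τ := by
  induction l generalizing π with
  | nil => rfl
  | cons j l ih =>
    have hj := hl j (by simp)
    simp only [List.map_cons, codewords]
    rw [push_mul_windowHom h hj.1 hj.2, ih fun i hi => hl i (by simp [hi])]

theorem foldl_mul_windowHom {n k p : ℕ} (h : p + k ≤ n) {l : List ℕ}
    (hl : ∀ j ∈ l, 0 < j ∧ j < k) (σ : Perm (Fin n)) (π : Perm (Fin k)) :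
    (l.map (p + ·)).foldl (fun τ j => push p j τ) (σ * windowHom h π) =
      σ * windowHom h (l.foldl (fun τ j => push 0 j τ) π) := by
  induction l generalizing π with
  | nil => rfl
  | cons j l ih =>
    have hj := hl j (by simp)
    simp only [List.map_cons, List.foldl_cons]
    rw [push_mul_windowHom h hj.1 hj.2, ih fun i hi => hl i (by simp [hi])]

theorem windowHom_injective {n k p : ℕ} (h : p + k ≤ n) : Function.Injective (windowHom h) :=
  Perm.viaEmbeddingHom_injective _

/-- A push-to-the-top code can be carried out, from any permutation, within a window. -/
theorem IsPushCode.map_window {n k p : ℕ} (h : p + k ≤ n) {l : List ℕ} {π : Perm (Fin k)}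
    (hl : IsPushCode 0 π l) (σ : Perm (Fin n)) : IsPushCode p σ (l.map (p + ·)) := by
  -- Right transitions commute with left multiplication, so translating by `τ` turns the start `π`
  -- into the start `σ`.
  obtain ⟨σ, rfl⟩ : ∃ τ, τ * windowHom h π = σ := ⟨σ * (windowHom h π)⁻¹, by simp⟩
  refine ⟨?_, ?_, ?_⟩
  · intro j hj
    obtain ⟨i, hi, rfl⟩ := List.mem_map.1 hj
    have := hl.transitions i hi
    lia
  · rw [codewords_mul_windowHom h hl.transitions]
    exact hl.distinct.map fun a b hab => windowHom_injective h (mul_left_cancel hab)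
  · rw [foldl_mul_windowHom h hl.transitions, hl.cyclic]

/-! ## The recursion step -/

/-- The quotient `c'⁻¹ * c` fixes the positions before `p + k` by agreement, and those after it
because it is a permutation of the window. A permutation that fixes all points but one is the
identity. -/
theorem eq_of_mul_windowHom_eq {n k p : ℕ} (h : p + (k + 1) ≤ n) {c c' : Perm (Fin n)}
    (hc : ∀ x : Fin n, (x : ℕ) < p + k → c x = c' x) {π π' : Perm (Fin (k + 1))}
    (he : c * windowHom h π = c' * windowHom h π') : c = c' := by
  have hE : c'⁻¹ * c = windowHom h (π' * π⁻¹) := by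
    rw [map_mul, map_inv, inv_mul_eq_iff_eq_mul, ← mul_assoc, ← he]
    simp
  have hfix (x : Fin n) (hx : (x : ℕ) ≠ p + k) : (c'⁻¹ * c) x = x := by
    rcases lt_or_gt_of_ne hx with hx | hx
    · simp [hc x hx]
    · rw [hE]
      exact windowHom_apply_of_notMem h _ (.inr (by lia))
  have hone : c'⁻¹ * c = 1 := by
    ext x
    by_cases hx : (x : ℕ) = p + k
    · by_contra hne
      have hne' : ((c'⁻¹ * c) x : ℕ) ≠ p + k := by
        rw [← hx]
        exact hne
      have := (c'⁻¹ * c).injective (hfix _ hne')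
      exact hne (by rw [this]; rfl)
    · rw [hfix x hx]
      rfl
  exact (inv_mul_eq_one.1 hone).symm

section Step

variable {n k p : ℕ} {t js : List ℕ}

/-- By `push_push`, `push p j σ` is the second codeword of the auxiliary cycle that starts at `push
(p + k) j σ`; the remaining transitions `t` close that cycle. -/
theorem foldl_expand_block (h : p + (k + 1) ≤ n) (hk : 0 < k)
    (haux : IsPushCode 0 (1 : Perm (Fin (k + 1))) (k :: t)) {j : ℕ} (hj : p + k < j ∧ j < n)
    (σ : Perm (Fin n)) :
    (t.map (p + ·)).foldl (fun π j => push p j π) (push p j σ) = push (p + k) j σ := by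
  have := ((haux.map_window h) (push (p + k) j σ)).cyclic
  simpa [push_push (by lia : p < p + k) hj.1 hj.2] using this

theorem foldl_expand (h : p + (k + 1) ≤ n) (hk : 0 < k)
    (haux : IsPushCode 0 (1 : Perm (Fin (k + 1))) (k :: t))
    (hjs : ∀ j ∈ js, p + k < j ∧ j < n) (σ : Perm (Fin n)) :
    (expand p (k :: t) js).foldl (fun π j => push p j π) σ =
      js.foldl (fun π j => push (p + k) j π) σ := by
  induction js generalizing σ with
  | nil => rfl
  | cons j js ih =>
    have ih := ih fun i hi => hjs i (by simp [hi])
    simp only [expand, List.tail_cons] at ih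
    simp only [expand, List.flatMap_cons, List.tail_cons, List.foldl_append, List.foldl_cons]
    rw [foldl_expand_block h hk haux (hjs j (by simp)), ih]

/-- The expanded code runs through the auxiliary code once for each codeword. -/
theorem codewords_expand_perm (h : p + (k + 1) ≤ n) (hk : 0 < k)
    (haux : IsPushCode 0 (1 : Perm (Fin (k + 1))) (k :: t))
    (hjs : ∀ j ∈ js, p + k < j ∧ j < n) (σ : Perm (Fin n)) :
    -- Each block of the expanded code lists the auxiliary cycle of the next codeword, while the
    -- codeword itself opens the block after. The incomplete cycle of the first codeword on the left
    -- and that of the final one on the right compensate for this shift, so that the induction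
    -- telescopes.
    (codewords p (push p (p + k) σ) (t.map (p + ·)) ++ codewords p σ (expand p (k :: t) js)).Perm
      ((codewords (p + k) σ js).flatMap (fun c => codewords p c ((k :: t).map (p + ·))) ++
        codewords p (push p (p + k) (js.foldl (fun π j => push (p + k) j π) σ))
          (t.map (p + ·))) := by
  induction js generalizing σ with
  | nil => simp [codewords, expand]
  | cons j js ih =>
    have hj := hjs j (by simp)
    have ih := ih (fun i hi => hjs i (by simp [hi])) (push (p + k) j σ)
    rw [push_push (by lia) hj.1 hj.2] at ih
    simp only [expand, List.tail_cons, List.map_cons] at ih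
    simp only [expand, List.flatMap_cons, List.tail_cons, List.foldl_cons, codewords_append,
      codewords, List.map_cons]
    rw [foldl_expand_block h hk haux hj]
    refine List.perm_middle.trans ?_
    rw [List.cons_append, List.cons_append, List.append_assoc]
    exact (ih.append_left _).cons _

theorem IsPushCode.expand (h : p + (k + 1) ≤ n) (hk : 0 < k)
    (haux : IsPushCode 0 (1 : Perm (Fin (k + 1))) (k :: t)) {σ : Perm (Fin n)}
    (hjs : IsPushCode (p + k) σ js) : IsPushCode p σ (expand p (k :: t) js) := by
  refine ⟨?_, ?_, ?_⟩
  · intro j hj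
    simp only [PushGray.expand, List.tail_cons, List.mem_flatMap, List.mem_cons,
      List.mem_map] at hj
    obtain ⟨i, hi, rfl | ⟨l, hl, rfl⟩⟩ := hj
    · have := hjs.transitions j hi
      lia
    · have := haux.transitions l (by simp [hl])
      lia
  · have hp := codewords_expand_perm h hk haux hjs.transitions σ
    rw [hjs.cyclic] at hp
    -- The outer code is cyclic, so the two incomplete cycles coincide and cancel.
    have hp := (List.perm_append_left_iff _).1 (hp.trans List.perm_append_comm)
    refine hp.nodup_iff.2 (List.nodup_flatMap.2
      ⟨fun c _ => (haux.map_window h c).distinct, hjs.distinct.imp_of_mem ?_⟩)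
    intro c c' hc hc' hne x hx hx'
    dsimp only at hx hx'
    -- Writing `c` as `c * windowHom h 1` exhibits its block inside a left coset of the window
    -- group.
    rw [← mul_one c, ← map_one (windowHom h), codewords_mul_windowHom h haux.transitions,
      List.mem_map] at hx
    rw [← mul_one c', ← map_one (windowHom h), codewords_mul_windowHom h haux.transitions,
      List.mem_map] at hx'
    obtain ⟨π, -, rfl⟩ := hx
    obtain ⟨π', -, he⟩ := hx'
    refine hne (eq_of_mul_windowHom_eq h (fun x hx => ?_) he.symm)
    rw [apply_eq_of_mem_codewords hc hx, apply_eq_of_mem_codewords hc' hx]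
  · rw [foldl_expand h hk haux hjs.transitions, hjs.cyclic]

end Step

theorem isPushCode_replicate_three {n i : ℕ} (h : i + 2 < n) (σ : Perm (Fin n)) :
    IsPushCode i σ (List.replicate 3 (i + 2)) := by
  have hE : i + 3 ≤ n := h
  have h3 : IsPushCode 0 (1 : Perm (Fin 3)) (List.replicate 3 2) :=
    ⟨by simp, by decide, by decide⟩
  simpa using h3.map_window hE σ

/-! ## Classes -/

theorem classSize_eq {n d m : ℕ} (hm : m < d) :
    classSize n d m = n / d + if m < n % d then 1 else 0 := by
  have := Nat.count_modEq_card n (r := d) (by lia) m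
  rw [Nat.mod_eq_of_lt hm] at this
  rw [← this, classSize, Nat.count_eq_card_filter_range]
  simp [Nat.ModEq, Nat.mod_eq_of_lt hm]

theorem classStart_succ (n d m : ℕ) : classStart n d (m + 1) = classStart n d m + classSize n d m :=
  Finset.sum_range_succ _ _

/-- The residue classes are the fibres of reduction modulo `d`, and they partition `{0, …, n - 1}`.
-/
theorem classStart_self {n d : ℕ} (hd : 0 < d) : classStart n d d = n := by
  have h := Finset.card_eq_sum_card_fiberwise (s := Finset.range n) (t := Finset.range d)
    (f := (· % d)) fun v _ => Finset.mem_coe.2 (Finset.mem_range.2 (Nat.mod_lt v hd))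
  rw [Finset.card_range] at h
  exact h.symm

theorem classStart_of_lt_two_mul {n d m : ℕ} (h₁ : d < n) (h₂ : n < 2 * d) (hm : m ≤ n % d) :
    classStart n d m = 2 * m := by
  have hf : n / d = 1 := Nat.div_eq_of_lt_le (by lia) (by lia)
  have := Nat.mod_lt n (by lia : d > 0)
  induction m with
  | zero => rfl
  | succ m ih =>
    rw [classStart_succ, ih (by lia), classSize_eq (by lia), hf, if_pos (by lia)]
    ring

theorem classSize_pos {n d m : ℕ} (h : d ≤ n) (hm : m < d) : 0 < classSize n d m := by
  rw [classSize_eq hm]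
  have := Nat.div_pos h (by lia)
  lia

theorem length_expand (p : ℕ) {aux : List ℕ} (h : aux ≠ []) (js : List ℕ) :
    (expand p aux js).length = js.length * aux.length := by
  have := List.length_pos_of_ne_nil h
  have h : aux.length - 1 + 1 = aux.length := by lia
  simp [expand, List.length_flatMap, h]

theorem IsAuxCode.exists_eq_cons {k : ℕ} {aux : List ℕ} (h : IsAuxCode (k + 1) aux) :
    ∃ t, aux = k :: t := by
  have := h.head_eq
  match aux with
  | [] => simp at this
  | a :: t => exact ⟨t, by simpa using this⟩

/-! ## The stages of the construction -/

theorem IsStage.lt {n d m : ℕ} {js : List ℕ} (hd : 0 < d) (h : IsStage n d m js) : m < d := by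
  induction h with
  | base => lia
  | baseSmall =>
    have := Nat.mod_lt n hd
    lia
  | step => lia

theorem IsStage.isPushCode {n d m : ℕ} {js : List ℕ} (hd : 0 < d) (hn : d < n)
    (h : IsStage n d m js) (σ : Perm (Fin n)) : IsPushCode (classStart n d m) σ js := by
  induction h generalizing σ with
  | base js _ hjs =>
    obtain ⟨-, π, hπ⟩ := hjs
    refine hπ.map_window (le_of_eq ?_) σ
    rw [← classStart_succ, Nat.sub_add_cancel hd, classStart_self hd]
  | baseSmall h2 =>
    have hr : n % d = n - d := by
      rw [Nat.mod_eq_sub_mod hn.le, Nat.mod_eq_of_lt (by lia)]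
    -- Hence `n % d - 1` is not truncated, and the three shifted positions are `2 * (n % d) - 2, …,
    -- 2 * (n % d)`.
    have h0 : 0 < n % d := by lia
    rw [classStart_of_lt_two_mul hn h2 (by lia)]
    have := isPushCode_replicate_three (i := 2 * (n % d - 1)) (by lia) σ
    rwa [show 2 * (n % d - 1) + 2 = 2 * (n % d) by lia] at this
  | step m js aux hjs haux ih =>
    obtain ⟨t, rfl⟩ := haux.exists_eq_cons
    have hm := hjs.lt hd
    have hle : classStart n d (m + 1 + 1) ≤ classStart n d d :=
      Finset.sum_le_sum_of_subset (Finset.range_mono (by lia))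
    have h1 := classSize_pos hn.le hm
    rw [classStart_self hd, classStart_succ, classStart_succ] at hle
    have ih := ih σ
    rw [classStart_succ] at ih
    -- The window fits because class `m + 1` is nonempty (`h1`) and contributes its first position.
    exact IsPushCode.expand (by lia) (classSize_pos hn.le (by lia)) haux.isPushCode ih

theorem IsStage.length_of_two_mul_le {n d m : ℕ} {js : List ℕ} (h2 : 2 * d ≤ n)
    (h : IsStage n d m js) : js.length =
      -- The last class is excluded from the product: it is already exhausted by the complete base
      -- code. The bound on `m` is carried along so that a factor can be split off at each step.
      (classSize n d (d - 1)).factorial *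
        ∏ i ∈ Finset.Ico m (d - 1), auxSize (classSize n d i + 1) ∧ m ≤ d - 1 := by
  induction h with
  | base js _ hjs => simp [hjs.1]
  | baseSmall h => lia
  | step m js aux hjs haux ih =>
    refine ⟨?_, by lia⟩
    obtain ⟨t, rfl⟩ := haux.exists_eq_cons
    rw [length_expand _ (by simp), ih.1, haux.length_eq,
      Finset.prod_eq_prod_Ico_succ_bot (by lia : m < d - 1)]
    ring

theorem IsStage.length_of_lt_two_mul {n d m : ℕ} {js : List ℕ} (hn : d < n) (h2 : n < 2 * d)
    (h : IsStage n d m js) : js.length = 3 ^ (n % d - m) ∧ m < n % d := by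
  have hr : n % d = n - d := by
    rw [Nat.mod_eq_sub_mod hn.le, Nat.mod_eq_of_lt (by lia)]
  have hf : n / d = 1 := Nat.div_eq_of_lt_le (by lia) (by lia)
  induction h with
  | base js h _ => lia
  | baseSmall h =>
    refine ⟨?_, by lia⟩
    rw [show n % d - (n % d - 1) = 1 by lia]
    simp
  | step m js aux hjs haux ih =>
    refine ⟨?_, by lia⟩
    obtain ⟨t, rfl⟩ := haux.exists_eq_cons
    rw [length_expand _ (by simp), ih.1, haux.length_eq, classSize_eq (by lia), hf,
      if_pos (by lia), show n % d - m = n % d - (m + 1) + 1 by lia, pow_succ]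
    -- All classes reached here have two elements, and `auxSize 3` evaluates to `3`.
    rfl

/-! ## The size formula -/

theorem auxSize_of_odd {k : ℕ} (h1 : k ≠ 1) (hk : k ≠ 5) (h : k % 2 = 1) :
    (auxSize k : ℚ) = (k.factorial : ℚ) / 2 := by
  rw [auxSize, if_neg (by lia), if_neg hk, if_neg (by lia), if_pos h]
  rw [Nat.cast_div (Nat.dvd_factorial (by lia) (by lia)) (by norm_num)]
  norm_num

theorem auxSize_of_even {k : ℕ} (hk : 6 < k) (h : k % 2 = 0) :
    (auxSize k : ℚ) = rho k * ((k.factorial : ℚ) / 2) := by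
  have h0 : (k.factorial : ℚ) ≠ 0 := by exact_mod_cast k.factorial_ne_zero
  rw [auxSize, if_neg (by lia), if_neg (by lia), if_neg (by lia), if_neg (by lia), rho,
    div_mul_cancel₀ _ (by positivity)]
  push_cast [Nat.cast_sub (by lia : 3 ≤ k)]
  rw [Nat.cast_div (Nat.dvd_factorial (by lia) (by lia)) (by norm_num)]
  norm_num

theorem prod_auxSize {n d : ℕ} (hd : 0 < d) :
    ∏ i ∈ Finset.Ico 0 (d - 1), auxSize (classSize n d i + 1) =
      auxSize (n / d + 2) ^ (n % d) * auxSize (n / d + 1) ^ (d - 1 - n % d) := by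
  have hr := Nat.mod_lt n hd
  rw [← Finset.prod_Ico_consecutive _ (Nat.zero_le (n % d)) (by lia : n % d ≤ d - 1)]
  congr 1
  · rw [Finset.prod_congr rfl (g := fun _ => auxSize (n / d + 2))]
    · simp
    · intro i hi
      rw [Finset.mem_Ico] at hi
      rw [classSize_eq (by lia), if_pos hi.2]
  · rw [Finset.prod_congr rfl (g := fun _ => auxSize (n / d + 1))]
    · simp
    · intro i hi
      rw [Finset.mem_Ico] at hi
      rw [classSize_eq (by lia), if_neg (by lia), add_zero]

/-- The excess of `rho k` over `(k - 3) / k` is `(2 * (k - 3) + 1) / (k! / 2)`, which is positive.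
-/
theorem rho_gt {k : ℕ} (hk : 6 < k) : ((k : ℚ) - 3) / k < rho k := by
  obtain ⟨m, rfl⟩ : ∃ m, k = m + 1 := ⟨k - 1, by lia⟩
  have h0 : (0 : ℚ) < (m.factorial : ℚ) := by exact_mod_cast m.factorial_pos
  have hm : (6 : ℚ) ≤ m := by exact_mod_cast (by lia : 6 ≤ m)
  rw [rho, Nat.factorial_succ, Nat.add_sub_cancel]
  push_cast
  rw [div_lt_div_iff₀ (by positivity) (by positivity)]
  nlinarith [mul_pos h0 (by linarith : (0 : ℚ) < m + 1)]

theorem ceil_div_eq {n d : ℕ} (hd : 0 < d) (hr : n % d ≠ 0) :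
    ⌈(n : ℚ) / d⌉₊ = n / d + 1 := by
  have hd' : (0 : ℚ) < d := by exact_mod_cast hd
  have h := Nat.div_add_mod n d
  have hlt := Nat.mod_lt n hd
  rw [Nat.ceil_eq_iff (by lia), Nat.add_sub_cancel, lt_div_iff₀ hd', div_le_iff₀ hd']
  constructor
  · exact_mod_cast (by nlinarith [Nat.pos_of_ne_zero hr] : n / d * d < n)
  · exact_mod_cast (by nlinarith : n ≤ (n / d + 1) * d)

theorem codeSize_of_lt_two_mul {n d : ℕ} (hn : d < n) (h2 : n < 2 * d) :
    codeSize n d = 3 ^ (n % d) := by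
  have hf : n / d = 1 := Nat.div_eq_of_lt_le (by lia) (by lia)
  simp [codeSize, Nat.floor_div_eq_div, hf]

theorem codeSize_of_two_mul_le {n d : ℕ} (hd : 0 < d) (h2 : 2 * d ≤ n) :
    codeSize n d = ((n / d).factorial : ℚ) *
      ((auxSize (n / d + 2) : ℚ) ^ (n % d) * (auxSize (n / d + 1) : ℚ) ^ (d - 1 - n % d)) := by
  have hf2 : 2 ≤ n / d := (Nat.le_div_iff_mul_le hd).2 h2
  have hlt := Nat.mod_lt n hd
  have hc : n % d ≠ 0 → ⌈(n : ℚ) / d⌉₊ = n / d + 1 := ceil_div_eq hd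
  unfold codeSize
  rw [Nat.floor_div_eq_div]
  generalize n / d = f at *
  generalize ⌈(n : ℚ) / d⌉₊ = c at *
  generalize n % d = r at *
  -- Here `e = d - 1 - r` counts the classes of size `f` other than the last; the substitution
  -- removes truncated subtraction from the exponents.
  obtain ⟨e, rfl⟩ : ∃ e, d = r + e + 1 := ⟨d - 1 - r, by lia⟩
  have he : r + e + 1 - 1 = r + e := rfl
  have he' : r + e - r = e := by lia
  dsimp only
  rw [he, he']
  have hfac : ((f.factorial : ℕ) : ℚ) ≠ 0 := by exact_mod_cast f.factorial_ne_zero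
  have hf1 : ((f : ℚ) + 1) ≠ 0 := by positivity
  -- The ceiling occurs only in `r`-th powers: it is `f + 1` when `r ≠ 0`, and irrelevant when `r =
  -- 0`.
  have hcr (g : ℕ → ℚ) : g c ^ r = g (f + 1) ^ r := by
    by_cases hr : r = 0
    · simp [hr]
    · rw [hc hr]
  split_ifs with h₁ h₂ h₃ h₄ h₅ h₆
  -- For even `f` the factor `rho` comes from the larger classes, with `f + 2` even; for odd `f` it
  -- comes from the smaller ones, with `f + 1` even.
  · rw [hcr fun c => (c : ℚ) + 1, hcr fun c => rho (c + 1), auxSize_of_even (by lia) (by lia),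
      auxSize_of_odd (by lia) (by lia) (by lia)]
    rw [Nat.factorial_succ (f + 1), Nat.factorial_succ f]
    push_cast
    simp only [mul_pow, div_pow, pow_add, pow_one]
    field_simp
  · subst h₂
    norm_num [auxSize, Nat.factorial, pow_add, div_pow]
    field_simp
  · subst h₃
    norm_num [auxSize, Nat.factorial, pow_add, div_pow]
    field_simp
  · rw [hcr fun c => (c : ℚ) + 1, auxSize_of_even (k := f + 1) (by lia) (by lia),
      auxSize_of_odd (k := f + 2) (by lia) (by lia) (by lia)]
    rw [Nat.factorial_succ (f + 1), Nat.factorial_succ f]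
    push_cast
    simp only [mul_pow, div_pow, pow_add, pow_one]
    field_simp
  · subst h₅
    norm_num [auxSize, Nat.factorial, pow_add, div_pow]
    -- The ratio `2520 / 178` appears in lowest terms as `1260 / 89`; extracting `2 ^ r` makes the
    -- powers comparable.
    have h2520 : (2520 : ℚ) ^ r = 1260 ^ r * 2 ^ r := by rw [← mul_pow]; norm_num
    have h178 : (178 : ℚ) ^ r = 89 ^ r * 2 ^ r := by rw [← mul_pow]; norm_num
    rw [h2520, h178]
    field_simp
    norm_num
  · subst h₆
    norm_num [auxSize, Nat.factorial, pow_add, div_pow]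
    field_simp
    norm_num
  · lia

theorem IsConstructedCode.card_eq {n d : ℕ} (hd : 0 < d) (hn : d < n) {C : List (Perm (Fin n))}
    (hC : IsConstructedCode n d C) : (C.toFinset.card : ℚ) = codeSize n d := by
  obtain ⟨σ₀, js, -, hjs, rfl⟩ := hC
  rw [List.toFinset_card_of_nodup (l := codewords 0 σ₀ js)
    (hjs.isPushCode hd hn σ₀).distinct, length_codewords]
  rcases lt_or_ge n (2 * d) with h2 | h2
  · rw [codeSize_of_lt_two_mul hn h2, (hjs.length_of_lt_two_mul hn h2).1]
    simp
  · rw [codeSize_of_two_mul_le hd h2, (hjs.length_of_two_mul_le h2).1, prod_auxSize hd,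
      -- Since `n % d ≤ d - 1`, the last class has exactly `n / d` elements.
      classSize_eq (by lia : d - 1 < d), if_neg (by have := Nat.mod_lt n hd; lia)]
    push_cast
    rfl

end PushGray

theorem mainTheorem8 :
    (∀ (n d : ℕ), 0 < d → d < n → ∀ C : List (Equiv.Perm (Fin n)),
      PushGray.IsConstructedCode n d C → (C.toFinset.card : ℚ) = PushGray.codeSize n d) ∧
    (∀ k : ℕ, 6 < k → Even k → ((k : ℚ) - 3) / k < PushGray.rho k) :=
  ⟨fun _ _ hd hn _ hC => hC.card_eq hd hn, fun _ hk _ => PushGray.rho_gt hk⟩
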